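/- Let $X$ be a finite abelian group (written additively) of order $q\geqslant 2$. For positive integers $k\leqslant n$ and $\beta\in X^n$ let $\mathrm{supp}(\beta)=\{i\in[1,n] : \beta_i\neq 0\}$, and let $\mathrm{wt}_k(\beta)$ be the least number of $k$-element subsets of $[1,n]$ whose union contains $\mathrm{supp}(\beta)$ (so $\mathrm{wt}_k(\beta)=\lceil|\mathrm{supp}(\beta)|/k\rceil$). Let $\mathcal{CO}(X^n,\mathcal P(k,[1,n]))$ be the partition of $X^n$ in which $\beta,\theta$ lie in the same member if and only if $\mathrm{wt}_k(\beta)=\mathrm{wt}_k(\theta)$. For a partition $\Gamma$ of a finite abelian group $H$ with character group $\widehat H=\mathrm{Hom}(H,\mathbb C^*)$, the dual partition $\widehat\Gamma$ of $\widehat H$ is defined by: $\chi,\psi$ lie in the same member if and only if $\sum_{b\in B}\chi(b)=\sum_{b\in B}\psi(b)$ for all $B\in\Gamma$. Identifying $H$ with its double character group by evaluation, $\Gamma$ is called reflexive if $\Gamma=\widehat{\widehat\Gamma}$, and non-reflexive otherwise. Then the following four statements hold. (1) For every integer $k\geqslant 2$ with $(k,q)\neq(2,2)$ there is a positive integer $m$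 such that for all integers $n$ with $n\geqslant m$ and $n\geqslant k+1$, the partition $\mathcal{CO}(X^n,\mathcal P(k,[1,n]))$ is non-reflexive. (2) If $q\geqslant 3$, then $\mathcal{CO}(X^n,\mathcal P(2,[1,n]))$ is non-reflexive for all $n\geqslant 3$. (3) Let $n$ be a positive integer satisfying one of the following three conditions: 3.1) $3\mid n$ and $n\geqslant\dfrac{9(q-1)+\sqrt{48q^4-144q^3+189q^2-162q+81}}{2(2q-3)^2}+3$; 3.2) $n\equiv 1\pmod 3$, $n\geqslant 4$ and $q\geqslant 3$; 3.3) $n\equiv 2\pmod 3$ and $n\geqslant\dfrac{4q^2+3q-9+\sqrt{48q^4-72q^3+9q^2-54q+81}}{2(2q-3)^2}+3$. Then $n\geqslant 4$ and $\mathcal{CO}(X^n,\mathcal P(3,[1,n]))$ is non-reflexive. (4) If $q=2$, then $\mathcal{CO}(X^n,\mathcal P(3,[1,n]))$ is non-reflexive for all $n\geqslant 5$. -/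

import Mathlib

/-! Partitions of a finite set are represented by setoids: `Γ.classes` is the set of members
of the partition, and `Γ a b` says that `a` and `b` lie in the same member. -/

/-- The dual partition of a partition `Γ` of a finite abelian group `H` (written additively).
It is a partition of the character group of `H`: two characters belong to the same member if and
only if they have the same sum over every member of `Γ`. -/
def dualPartition {H : Type*} [AddCommGroup H] (Γ : Setoid H) : Setoid (AddChar H ℂ) where
  r χ ψ := ∀ B ∈ Γ.classes, ∑ᶠ b ∈ B, χ b = ∑ᶠ b ∈ B, ψ b
  iseqv := ⟨fun _ _ _ => rfl, fun h B hB => (h B hB).symm,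
    fun h₁ h₂ B hB => (h₁ B hB).trans (h₂ B hB)⟩

/-- The bi-dual partition of `Γ`: the dual partition of the dual partition, regarded as a
partition of `H` through the canonical map `b ↦ (χ ↦ χ b)` from `H` to its double character
group, which is an isomorphism for every finite abelian group `H`. -/
def bidualPartition {H : Type*} [AddCommGroup H] (Γ : Setoid H) : Setoid H :=
  Setoid.comap (AddChar.doubleDualEmb : H →+ AddChar (AddChar H ℂ) ℂ)
    (dualPartition (dualPartition Γ))

/-- A partition of a finite abelian group is reflexive if it coincides with its bi-dual. -/
def IsReflexivePartition {H : Type*} [AddCommGroup H] (Γ : Setoid H) : Prop :=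
  Γ = bidualPartition Γ

/-- For a covering `T` of a finite set `Ω`, the least number of members of `T` whose union
contains `A`. -/
noncomputable def coverNumber {Ω : Type*} (T : Set (Set Ω)) (A : Set Ω) : ℕ :=
  sInf {m : ℕ | ∃ S : Set (Set Ω), S ⊆ T ∧ A ⊆ ⋃₀ S ∧ S.ncard = m}

/-- The set of all the subsets of `Ω` of cardinality `r`. -/
def subsetsOfCard (r : ℕ) (Ω : Type*) : Set (Set Ω) := {A | A.ncard = r}

/-- The `T`-weight of a codeword: the covering number of its support. -/
noncomputable def combWeight {Ω X : Type*} [AddCommGroup X] (T : Set (Set Ω)) (β : Ω → X) : ℕ :=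
  coverNumber T (Function.support β)

/-- The partition of `X ^ Ω` induced by the `T`-combinatorial metric: two codewords belong to the
same member if and only if they have the same `T`-weight. -/
def combPartition {Ω : Type*} (X : Type*) [AddCommGroup X] (T : Set (Set Ω)) :
    Setoid (Ω → X) where
  r β θ := combWeight T β = combWeight T θ
  iseqv := ⟨fun _ => rfl, fun h => h.symm, fun h₁ h₂ => h₁.trans h₂⟩

/-! The proof counts members. The Fourier transform embeds functions constant on the members of `Γ`
into functions constant on the members of its dual, so the dual has at least as many members as `Γ`.
Applying this to the dual, a reflexive `Γ` has at least as many members as its dual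
(`IsReflexivePartition.card_quotient_dualPartition_le`).

Put `n = m + 1`. There are at most `m / k + 2` weights. A character that is nontrivial on exactly `u
+ 1` coordinates sums over the ball of Hamming radius `j * k` to the Krawtchouk value `K_{jk}(u)` of
length `m`. The trivial character accounts for one further member, so under reflexivity each map `u
↦ K_{jk}(u)` on `0, ..., m` takes at most `m / k + 1` values.

As a polynomial of degree `k` in `u`, `K_k` takes each value at most `k` times. This alone barely
allows reflexivity; the contradiction comes from extreme values at the ends of the range, taken too
rarely (`IsReflexivePartition.card_le_of_disjoint`), or, for `q ≥ 3` and `k ∣ m`, from the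
injectivity of `K_m`. -/

/-! ### Covering numbers by `k`-subsets. -/

theorem exists_cover_of_ncard_le {Ω : Type*} [Finite Ω] {k : ℕ} (hkn : k ≤ Nat.card Ω) (j : ℕ) :
    ∀ A : Set Ω, A.ncard ≤ j * k →
      ∃ S : Set (Set Ω), S ⊆ subsetsOfCard k Ω ∧ A ⊆ ⋃₀ S ∧ S.ncard ≤ j := by
  induction j with
  | zero =>
    intro A hA
    have : A = ∅ := (Set.ncard_eq_zero).1 (by omega)
    exact ⟨∅, by simp, by simp [this], by simp⟩
  | succ j ih =>
    intro A hA
    rcases le_total A.ncard k with h | h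
    · obtain ⟨u, hu, -, huk⟩ := Set.exists_subsuperset_card_eq (Set.subset_univ A) h
        (by simpa [Set.ncard_univ] using hkn)
      exact ⟨{u}, by simpa [subsetsOfCard] using huk, by simpa using hu, by simp⟩
    · obtain ⟨t, htA, htk⟩ := Set.exists_subset_card_eq h
      have hd : (A \ t).ncard ≤ j * k := by
        rw [Set.ncard_sdiff htA, htk]
        rw [add_mul, one_mul] at hA
        omega
      obtain ⟨S, hS, hAS, hSj⟩ := ih _ hd
      refine ⟨insert t S, Set.insert_subset htk hS, ?_, (Set.ncard_insert_le t S).trans (by omega)⟩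
      rw [Set.sUnion_insert]
      exact fun x hx => or_iff_not_imp_left.2 fun hxt => hAS ⟨hx, hxt⟩

theorem ncard_sUnion_le_mul {Ω : Type*} [Finite Ω] {k : ℕ} (S : Set (Set Ω))
    (hS : S ⊆ subsetsOfCard k Ω) : (⋃₀ S).ncard ≤ S.ncard * k := by
  induction S, S.toFinite using Set.Finite.induction_on with
  | empty => simp
  | @insert a s ha hs ih =>
    rw [Set.sUnion_insert, Set.ncard_insert_of_notMem ha, add_mul, one_mul]
    have h1 : a.ncard = k := hS (Set.mem_insert a s)
    have h2 := ih ((Set.subset_insert a s).trans hS)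
    have h3 := Set.ncard_union_le a (⋃₀ s)
    omega

theorem coverNumber_subsetsOfCard_le_iff {Ω : Type*} [Finite Ω] {k : ℕ} (hk : 0 < k)
    (hkn : k ≤ Nat.card Ω) (A : Set Ω) (j : ℕ) :
    coverNumber (subsetsOfCard k Ω) A ≤ j ↔ A.ncard ≤ j * k := by
  constructor
  · intro h
    -- `sInf ∅ = 0`, so the infimum is attained only once some cover is known to exist.
    have hne : {m : ℕ | ∃ S : Set (Set Ω), S ⊆ subsetsOfCard k Ω ∧ A ⊆ ⋃₀ S ∧
        S.ncard = m}.Nonempty := by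
      obtain ⟨S, h1, h2, -⟩ := exists_cover_of_ncard_le hkn A.ncard A (Nat.le_mul_of_pos_right _ hk)
      exact ⟨_, S, h1, h2, rfl⟩
    obtain ⟨S, hS, hAS, hSm⟩ : _ ∈ {m : ℕ | ∃ S : Set (Set Ω), S ⊆ subsetsOfCard k Ω ∧
        A ⊆ ⋃₀ S ∧ S.ncard = m} := Nat.sInf_mem hne
    calc A.ncard ≤ (⋃₀ S).ncard := Set.ncard_le_ncard hAS
      _ ≤ S.ncard * k := ncard_sUnion_le_mul S hS
      _ ≤ j * k := Nat.mul_le_mul_right k (by rw [hSm]; exact h)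
  · intro h
    obtain ⟨S, h1, h2, h3⟩ := exists_cover_of_ncard_le hkn j A h
    have h4 : coverNumber (subsetsOfCard k Ω) A ≤ S.ncard := Nat.sInf_le ⟨S, h1, h2, rfl⟩
    exact h4.trans h3

/-! ### Numbers of members of a partition and of its dual. -/

section Duality

variable {H : Type*} [AddCommGroup H]

theorem sum_mul_eq_of_dualPartition [Fintype H] {Γ : Setoid H} {χ ψ : AddChar H ℂ}
    (h : dualPartition Γ χ ψ) (f : Quotient Γ → ℂ) :
    ∑ b, f ⟦b⟧ * χ b = ∑ b, f ⟦b⟧ * ψ b := by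
  classical
  rw [← Finset.sum_fiberwise Finset.univ (fun b => (⟦b⟧ : Quotient Γ)) (fun b => f ⟦b⟧ * χ b),
    ← Finset.sum_fiberwise Finset.univ (fun b => (⟦b⟧ : Quotient Γ)) (fun b => f ⟦b⟧ * ψ b)]
  refine Finset.sum_congr rfl fun c _ => ?_
  induction c using Quotient.inductionOn with
  | _ c =>
  have key : ∀ φ : AddChar H ℂ, ∑ b with (⟦b⟧ : Quotient Γ) = ⟦c⟧, f ⟦b⟧ * φ b =
      f ⟦c⟧ * ∑ᶠ b ∈ {x | Γ x c}, φ b := by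
    intro φ
    rw [finsum_mem_eq_finite_toFinset_sum _ (Set.toFinite _), Finset.mul_sum]
    refine Finset.sum_congr (by ext; simp [Quotient.eq]) fun b hb => ?_
    rw [show (⟦b⟧ : Quotient Γ) = ⟦c⟧ from Quotient.sound (by simpa using hb)]
  rw [key, key, h _ (Γ.mem_classes c)]

/-- The Fourier transform `F` is injective because evaluations at distinct points are distinct
characters of the dual group, hence linearly independent; then compare dimensions. -/
theorem card_quotient_le_card_quotient_dualPartition [Finite H] (Γ : Setoid H) :
    Nat.card (Quotient Γ) ≤ Nat.card (Quotient (dualPartition Γ)) := by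
  classical
  have := Fintype.ofFinite H
  let F : (Quotient Γ → ℂ) →ₗ[ℂ] (Quotient (dualPartition Γ) → ℂ) :=
    { toFun := fun f c => Quotient.lift (fun χ : AddChar H ℂ => ∑ b, f ⟦b⟧ * χ b)
        (fun _ _ h => sum_mul_eq_of_dualPartition h f) c
      map_add' := fun f g => by
        ext c
        induction c using Quotient.inductionOn with
        | _ c => simp [add_mul, Finset.sum_add_distrib]
      map_smul' := fun r f => by
        ext c
        induction c using Quotient.inductionOn with
        | _ c => simp [mul_assoc, Finset.mul_sum] }
  have hF : Function.Injective F := by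
    rw [← LinearMap.ker_eq_bot, LinearMap.ker_eq_bot']
    intro f hf
    have hli := (AddChar.linearIndependent (AddChar H ℂ) ℂ).comp _
      (AddChar.doubleDualEmb_injective (α := H))
    rw [Fintype.linearIndependent_iff] at hli
    ext c
    induction c using Quotient.inductionOn with
    | _ c =>
    refine hli (fun b => f ⟦b⟧) ?_ c
    ext χ
    simpa [F] using congrFun hf ⟦χ⟧
  have := Fintype.ofFinite (Quotient Γ)
  have := Fintype.ofFinite (Quotient (dualPartition Γ))
  simpa [Nat.card_eq_fintype_card] using LinearMap.finrank_le_finrank_of_injective hF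

theorem IsReflexivePartition.card_quotient_dualPartition_le [Finite H] {Γ : Setoid H}
    (h : IsReflexivePartition Γ) :
    Nat.card (Quotient (dualPartition Γ)) ≤ Nat.card (Quotient Γ) := by
  refine (card_quotient_le_card_quotient_dualPartition (dualPartition Γ)).trans ?_
  have hΓ : ∀ a b, Γ a b → dualPartition (dualPartition Γ) (AddChar.doubleDualEmb a)
      (AddChar.doubleDualEmb b) := by
    intro a b hab
    rw [h] at hab
    exact hab
  refine Nat.card_le_card_of_surjective (Quotient.map AddChar.doubleDualEmb hΓ) ?_
  intro c
  induction c using Quotient.inductionOn with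
  | _ φ =>
  obtain ⟨a, ha⟩ := (AddChar.doubleDualEquiv (α := H)).surjective φ
  exact ⟨⟦a⟧, congrArg _ ha⟩

end Duality

/-! ### Number of weights. -/

section CombPartition

variable {X : Type*} [AddCommGroup X]

theorem combWeight_le_iff {k n : ℕ} (hk : 0 < k) (hkn : k ≤ n) (β : Fin n → X) (j : ℕ) :
    combWeight (subsetsOfCard k (Fin n)) β ≤ j ↔ (Function.support β).ncard ≤ j * k :=
  coverNumber_subsetsOfCard_le_iff hk (by simpa using hkn) _ _

theorem card_quotient_combPartition_le {k m : ℕ} (hk : 0 < k) (hkm : k ≤ m + 1) :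
    Nat.card (Quotient (combPartition X (subsetsOfCard k (Fin (m + 1))))) ≤ m / k + 2 := by
  have hle : ∀ β : Fin (m + 1) → X,
      combWeight (subsetsOfCard k (Fin (m + 1))) β < m / k + 2 := by
    intro β
    rw [Nat.lt_succ_iff, combWeight_le_iff hk hkm]
    calc (Function.support β).ncard ≤ (Set.univ : Set (Fin (m + 1))).ncard :=
          Set.ncard_le_ncard (Set.subset_univ _)
      _ = m + 1 := by simp [Set.ncard_univ]
      _ ≤ (m / k + 1) * k := by rw [mul_comm]; exact Nat.lt_mul_div_succ m hk
  let g : Quotient (combPartition X (subsetsOfCard k (Fin (m + 1)))) → Fin (m / k + 2) :=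
    Quotient.lift (fun β => ⟨_, hle β⟩) fun a b h => Fin.ext h
  have hg : Function.Injective g := by
    intro a b
    induction a, b using Quotient.inductionOn₂ with
    | _ a b => exact fun h => Quotient.sound (congrArg Fin.val h)
  simpa using Nat.card_le_card_of_injective g hg

end CombPartition

/-! ### Krawtchouk values as polynomials in `u`. -/

open Polynomial

/-- The polynomial whose coefficients are the values at `u` of the `(a + 1)`-ary Krawtchouk
polynomials of length `m`. -/
noncomputable def krawtchoukGen (a : ℤ) (m u : ℕ) : ℤ[X] := (1 - X) ^ u * (1 + C a * X) ^ (m - u)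

theorem coeff_one_add_C_mul_X_pow (a : ℤ) (n i : ℕ) :
    ((1 + C a * X) ^ n : ℤ[X]).coeff i = a ^ i * n.choose i := by
  have h : ((1 + C a * X) ^ n : ℤ[X]) = ((1 + X) ^ n).comp (C a * X) := by simp
  rw [h, comp_C_mul_X_coeff, coeff_one_add_X_pow, mul_comm]

/-- Expand `(1 - X) ^ u` binomially with `1 - X = -(a + 1) X + (1 + a X)`. The dependence on `u` is
then only through `u.choose j` with `j ≤ k`, and the top coefficient is `(-(a + 1)) ^ k ≠ 0`. -/
theorem krawtchoukGen_eq_sum {a : ℤ} {m u k : ℕ} (hu : u ≤ m) :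
    (krawtchoukGen a m u).coeff k = ∑ j ∈ Finset.range (k + 1),
      (-(a + 1)) ^ j * ((1 + C a * X) ^ (m - j) : ℤ[X]).coeff (k - j) * (u.choose j : ℤ) := by
  have h1 : (1 - X : ℤ[X]) = C (-(a + 1)) * X + (1 + C a * X) := by
    simp only [map_neg, map_add, map_one]; ring
  have h2 : krawtchoukGen a m u = ∑ j ∈ Finset.range (u + 1),
      C ((-(a + 1)) ^ j * (u.choose j : ℤ)) * ((1 + C a * X) ^ (m - j) * X ^ j) := by
    rw [krawtchoukGen, h1, add_pow, Finset.sum_mul]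
    refine Finset.sum_congr rfl fun j hj => ?_
    have hj : m - j = (u - j) + (m - u) := by
      have := Finset.mem_range.1 hj
      omega
    rw [hj, pow_add, mul_pow, C_mul, C_pow]
    simp only [eq_intCast, Int.cast_natCast]
    ring
  rw [h2, finsetSum_coeff]
  simp only [coeff_C_mul, coeff_mul_X_pow']
  have h3 : ∀ N, u ≤ N → k ≤ N → ∑ j ∈ Finset.range (u + 1), ((-(a + 1)) ^ j * (u.choose j : ℤ) *
      if j ≤ k then ((1 + C a * X) ^ (m - j) : ℤ[X]).coeff (k - j) else 0) =
      ∑ j ∈ Finset.range (N + 1), ((-(a + 1)) ^ j * (u.choose j : ℤ) *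
      if j ≤ k then ((1 + C a * X) ^ (m - j) : ℤ[X]).coeff (k - j) else 0) := by
    intro N hN _
    refine Finset.sum_subset (Finset.range_subset_range.2 (by omega)) fun j _ hj => ?_
    rw [Nat.choose_eq_zero_of_lt (by simpa using hj)]
    simp
  rw [h3 (max u k) (le_max_left _ _) (le_max_right _ _)]
  symm
  have h4 : Finset.range (k + 1) ⊆ Finset.range (max u k + 1) :=
    Finset.range_subset_range.2 (by omega)
  rw [← Finset.sum_subset h4]
  · refine Finset.sum_congr rfl fun j hj => ?_
    rw [if_pos (by have := Finset.mem_range.1 hj; omega)]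
    ring
  · intro j _ hj
    rw [if_neg (by simpa using hj), mul_zero]

theorem card_filter_sum_choose_eq_le (k : ℕ) (c : ℕ → ℤ) (hc : c k ≠ 0) (s : Finset ℕ) (hk : 0 < k)
    (f : ℕ → ℤ) (hf : ∀ u ∈ s, f u = ∑ j ∈ Finset.range (k + 1), c j * (u.choose j : ℤ)) (v : ℤ) :
    (s.filter (fun u => f u = v)).card ≤ k := by
  let p : ℚ[X] := ∑ j ∈ Finset.range (k + 1), C ((c j : ℚ) / j.factorial) * descPochhammer ℚ j
  have hp : ∀ u : ℕ, p.eval (u : ℚ) =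
      ((∑ j ∈ Finset.range (k + 1), c j * (u.choose j : ℤ) : ℤ) : ℚ) := by
    intro u
    simp only [p, eval_finsetSum, eval_mul, eval_C, descPochhammer_eval_eq_descFactorial]
    push_cast
    refine Finset.sum_congr rfl fun j _ => ?_
    rw [Nat.descFactorial_eq_factorial_mul_choose]
    push_cast
    have : (j.factorial : ℚ) ≠ 0 := by exact_mod_cast j.factorial_ne_zero
    field_simp
  have hdeg : p.natDegree ≤ k := by
    refine natDegree_sum_le_of_forall_le _ _ fun j hj => ?_
    refine (natDegree_C_mul_le _ _).trans ?_
    rw [descPochhammer_natDegree]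
    have := Finset.mem_range.1 hj
    omega
  have hcoeff : p.coeff k = (c k : ℚ) / k.factorial := by
    simp only [p, finsetSum_coeff, coeff_C_mul]
    rw [Finset.sum_range_succ, Finset.sum_eq_zero, zero_add]
    · have h := (monic_descPochhammer ℚ k).coeff_natDegree
      rw [descPochhammer_natDegree] at h
      rw [h, mul_one]
    · intro j hj
      rw [coeff_eq_zero_of_natDegree_lt, mul_zero]
      rw [descPochhammer_natDegree]
      exact Finset.mem_range.1 hj
  -- Since `k > 0`, subtracting the constant `v` leaves the coefficient of degree `k` untouched.
  have hne : p - C (v : ℚ) ≠ 0 := by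
    intro h
    have h' : (p - C (v : ℚ)).coeff k = 0 := by rw [h, coeff_zero]
    rw [coeff_sub, coeff_C_of_ne_zero hk.ne', sub_zero, hcoeff] at h'
    have : (k.factorial : ℚ) ≠ 0 := by exact_mod_cast k.factorial_ne_zero
    simp_all
  have hroots : (s.filter (fun u => f u = v)).image (fun u : ℕ => (u : ℚ)) ⊆
      (p - C (v : ℚ)).roots.toFinset := by
    intro x hx
    obtain ⟨u, hu, rfl⟩ := Finset.mem_image.1 hx
    obtain ⟨hus, huv⟩ := Finset.mem_filter.1 hu
    rw [Multiset.mem_toFinset, mem_roots hne, IsRoot, eval_sub, eval_C, hp, ← hf u hus, huv, sub_self]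
  calc (s.filter (fun u => f u = v)).card
      = ((s.filter (fun u => f u = v)).image (fun u : ℕ => (u : ℚ))).card :=
        (Finset.card_image_of_injective _ Nat.cast_injective).symm
    _ ≤ (p - C (v : ℚ)).roots.toFinset.card := Finset.card_le_card hroots
    _ ≤ (p - C (v : ℚ)).roots.card := Multiset.toFinset_card_le _
    _ ≤ (p - C (v : ℚ)).natDegree := card_roots' _
    _ ≤ k := by rw [natDegree_sub_C]; exact hdeg

/-- A coefficient of the Krawtchouk generating polynomial of index `k` takes each value at
most `k` times. -/
theorem card_filter_krawtchoukGen_coeff_eq_le {a : ℤ} (ha : 0 < a) {m k : ℕ} (hk : 0 < k)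
    {s : Finset ℕ} (hs : ∀ u ∈ s, u ≤ m) (v : ℤ) :
    (s.filter (fun u => (krawtchoukGen a m u).coeff k = v)).card ≤ k := by
  refine card_filter_sum_choose_eq_le k (fun j => (-(a + 1)) ^ j *
    ((1 + C a * X) ^ (m - j) : ℤ[X]).coeff (k - j)) ?_ s hk _
    (fun u hu => krawtchoukGen_eq_sum (hs u hu)) v
  rw [coeff_one_add_C_mul_X_pow]
  simp
  omega

theorem krawtchoukGen_coeff_self {a : ℤ} {m u : ℕ} (hu : u ≤ m) :
    (krawtchoukGen a m u).coeff m = (-1) ^ u * a ^ (m - u) := by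
  have h1 : (1 - X : ℤ[X]).natDegree ≤ 1 := by compute_degree
  have h2 : (1 + C a * X : ℤ[X]).natDegree ≤ 1 := by compute_degree
  have h3 := coeff_mul_add_eq_of_natDegree_le (df := u) (dg := m - u)
    (natDegree_pow_le_of_le u h1 |>.trans (by simp)) (natDegree_pow_le_of_le (m - u) h2 |>.trans (by simp))
  have h4 := coeff_pow_of_natDegree_le (m := u) h1
  have h5 := coeff_pow_of_natDegree_le (m := m - u) h2
  rw [mul_one] at h4 h5
  rw [Nat.add_sub_cancel' hu] at h3
  rw [krawtchoukGen, h3, h4, h5]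
  simp [coeff_one, coeff_X]

theorem natDegree_krawtchoukGen_le {a : ℤ} {m u : ℕ} (hu : u ≤ m) :
    (krawtchoukGen a m u).natDegree ≤ m := by
  have h1 : (1 - X : ℤ[X]).natDegree ≤ 1 := by compute_degree
  have h2 : (1 + C a * X : ℤ[X]).natDegree ≤ 1 := by compute_degree
  have h3 := natDegree_mul_le_of_le (natDegree_pow_le_of_le u h1)
    (natDegree_pow_le_of_le (m - u) h2)
  rw [krawtchoukGen]
  omega

/-! ### Extreme Krawtchouk values, by coefficientwise domination. -/

theorem abs_coeff_mul_le {p p' r r' : ℤ[X]} (h : ∀ i, |p.coeff i| ≤ p'.coeff i)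
    (h' : ∀ i, |r.coeff i| ≤ r'.coeff i) (i : ℕ) : |(p * r).coeff i| ≤ (p' * r').coeff i := by
  rw [coeff_mul, coeff_mul]
  refine (Finset.abs_sum_le_sum_abs _ _).trans (Finset.sum_le_sum fun x _ => ?_)
  rw [abs_mul]
  exact mul_le_mul (h _) (h' _) (abs_nonneg _) ((abs_nonneg _).trans (h _))

theorem abs_coeff_pow_le {p p' : ℤ[X]} (h : ∀ i, |p.coeff i| ≤ p'.coeff i) (n : ℕ) :
    ∀ i, |(p ^ n).coeff i| ≤ (p' ^ n).coeff i := by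
  induction n with
  | zero =>
    intro i
    rw [pow_zero, pow_zero, coeff_one]
    split_ifs <;> simp
  | succ n ih => rw [pow_succ, pow_succ]; exact abs_coeff_mul_le ih h

theorem abs_krawtchoukGen_coeff_le {a : ℤ} (ha : 1 ≤ a) {m u : ℕ} (hu : u ≤ m) (i : ℕ) :
    |(krawtchoukGen a m u).coeff i| ≤ ((1 + C a * X) ^ m : ℤ[X]).coeff i := by
  have h1 : ∀ i, |(1 - X : ℤ[X]).coeff i| ≤ (1 + C a * X : ℤ[X]).coeff i := by
    intro i
    rcases i with _ | _ | i <;> simp [coeff_one, coeff_X, -eq_intCast, ha]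
  have h2 : ∀ i, |(1 + C a * X : ℤ[X]).coeff i| ≤ (1 + C a * X : ℤ[X]).coeff i := by
    intro i
    rcases i with _ | _ | i <;> simp [coeff_one, coeff_X, -eq_intCast, abs_of_pos, show 0 < a by omega]
  have := abs_coeff_mul_le (abs_coeff_pow_le h1 u) (abs_coeff_pow_le h2 (m - u)) i
  rwa [← pow_add, Nat.add_sub_cancel' hu] at this

theorem coeff_one_add_C_mul_X_pow_pos {a : ℤ} (ha : 0 < a) {n i : ℕ} (hi : i ≤ n) :
    0 < ((1 + C a * X) ^ n : ℤ[X]).coeff i := by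
  rw [coeff_one_add_C_mul_X_pow]
  have := Nat.choose_pos hi
  positivity

/-- Trade one factor `1 - X` for `1 + a X = (1 + X) + (a - 1) X`: the first summand dominates `1 -
X`, and the second is a strict gain because `a ≥ 2`. -/
theorem abs_krawtchoukGen_coeff_lt {a : ℤ} (ha : 2 ≤ a) {m u k : ℕ} (hu : u ≤ m) (hu0 : 0 < u)
    (hk : 0 < k) (hkm : k ≤ m) :
    |(krawtchoukGen a m u).coeff k| < (krawtchoukGen a m 0).coeff k := by
  obtain ⟨u, rfl⟩ : ∃ v, u = v + 1 := ⟨u - 1, by omega⟩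
  obtain ⟨m, rfl⟩ : ∃ v, m = v + 1 := ⟨m - 1, by omega⟩
  obtain ⟨k, rfl⟩ : ∃ v, k = v + 1 := ⟨k - 1, by omega⟩
  have h1 : krawtchoukGen a (m + 1) (u + 1) = (1 - X) * krawtchoukGen a m u := by
    simp only [krawtchoukGen, Nat.add_sub_add_right]; ring
  have h2 : ∀ i, |(1 - X : ℤ[X]).coeff i| ≤ (1 + X : ℤ[X]).coeff i := by
    intro i
    rcases i with _ | _ | i <;> simp [coeff_one, coeff_X]
  have h3 : krawtchoukGen a (m + 1) 0 = (1 + X) * (1 + C a * X) ^ m +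
      C (a - 1) * (1 + C a * X) ^ m * X := by
    simp only [krawtchoukGen, map_sub, map_one, Nat.sub_zero]; ring
  rw [h1, h3, coeff_add, coeff_mul_X, coeff_C_mul]
  have h4 := abs_coeff_mul_le h2 (abs_krawtchoukGen_coeff_le (a := a) (by omega) (by omega : u ≤ m)) (k + 1)
  have h5 : 0 < (a - 1) * ((1 + C a * X) ^ m : ℤ[X]).coeff k :=
    mul_pos (by omega) (coeff_one_add_C_mul_X_pow_pos (by omega) (by omega))
  omega

theorem abs_coeff_one_sub_X_sq_le (i : ℕ) :
    |(1 - X ^ 2 : ℤ[X]).coeff i| ≤ (1 + X ^ 2 : ℤ[X]).coeff i := by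
  rcases i with _ | _ | _ | i <;> simp [coeff_one, coeff_X_pow]

/-- For `a = 1` there is no gain from a single factor, so pair `(1 - X)(1 + X) = 1 - X ^ 2` against
`(1 + X) ^ 2 = (1 + X ^ 2) + 2 X`. -/
theorem abs_krawtchoukGen_one_coeff_lt {m u k : ℕ} (hu : u < m) (hu0 : 0 < u)
    (hk : 0 < k) (hkm : k < m) :
    |(krawtchoukGen 1 m u).coeff k| < (krawtchoukGen 1 m 0).coeff k := by
  obtain ⟨u, rfl⟩ : ∃ v, u = v + 1 := ⟨u - 1, by omega⟩
  obtain ⟨m, rfl⟩ : ∃ v, m = v + 2 := ⟨m - 2, by omega⟩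
  obtain ⟨k, rfl⟩ : ∃ v, k = v + 1 := ⟨k - 1, by omega⟩
  have h1 : krawtchoukGen 1 (m + 2) (u + 1) = (1 - X ^ 2) * krawtchoukGen 1 m u := by
    simp only [krawtchoukGen, show m + 2 - (u + 1) = m - u + 1 by omega, map_one]; ring
  have h3 : krawtchoukGen 1 (m + 2) 0 = (1 + X ^ 2) * (1 + C 1 * X) ^ m +
      C 2 * (1 + C 1 * X) ^ m * X := by
    simp only [krawtchoukGen, map_one, Nat.sub_zero, map_ofNat]; ring
  rw [h1, h3, coeff_add, coeff_mul_X, coeff_C_mul]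
  have h4 := abs_coeff_mul_le abs_coeff_one_sub_X_sq_le
    (abs_krawtchoukGen_coeff_le le_rfl (by omega : u ≤ m)) (k + 1)
  have h5 := coeff_one_add_C_mul_X_pow_pos one_pos (by omega : k ≤ m)
  omega

theorem four_mul_choose_le {n i : ℕ} (h : 5 * i + 4 ≤ n) : 4 * n.choose i ≤ n.choose (i + 1) := by
  have h1 := Nat.choose_succ_right_eq n i
  have h2 : n.choose i * (4 * (i + 1)) ≤ n.choose i * (n - i) := Nat.mul_le_mul_left _ (by omega)
  refine Nat.le_of_mul_le_mul_right (c := i + 1) ?_ (by omega)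
  linarith

/-- Compare `(1 - X ^ 2) ^ 2` with `(1 - X)(1 + X) ^ 3 = (1 + X ^ 2) ^ 2 + 2 (X - X ^ 2 - X ^ 3 - X
^ 4)`. The bound `5 * k ≤ m` makes consecutive binomials grow by a factor 4, so the `X` term
outweighs the three negative ones. -/
theorem abs_krawtchoukGen_one_coeff_lt_one {m u k : ℕ} (hu : u + 2 ≤ m) (hu2 : 2 ≤ u)
    (hk : 4 ≤ k) (hkm : 5 * k ≤ m) :
    |(krawtchoukGen 1 m u).coeff k| < (krawtchoukGen 1 m 1).coeff k := by
  obtain ⟨u, rfl⟩ : ∃ v, u = v + 2 := ⟨u - 2, by omega⟩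
  obtain ⟨m, rfl⟩ : ∃ v, m = v + 4 := ⟨m - 4, by omega⟩
  obtain ⟨k, rfl⟩ : ∃ v, k = v + 4 := ⟨k - 4, by omega⟩
  have h1 : krawtchoukGen 1 (m + 4) (u + 2) = (1 - X ^ 2) ^ 2 * krawtchoukGen 1 m u := by
    simp only [krawtchoukGen, show m + 4 - (u + 2) = m - u + 2 by omega, map_one]; ring
  have h3 : krawtchoukGen 1 (m + 4) 1 = (1 + X ^ 2) ^ 2 * (1 + C 1 * X) ^ m +
      C 2 * ((1 + C 1 * X) ^ m * X ^ 1 - (1 + C 1 * X) ^ m * X ^ 2 - (1 + C 1 * X) ^ m * X ^ 3 -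
        (1 + C 1 * X) ^ m * X ^ 4) := by
    simp only [krawtchoukGen, map_one, show m + 4 - 1 = m + 3 by omega, map_ofNat]; ring
  rw [h1, h3, coeff_add, coeff_C_mul, coeff_sub, coeff_sub, coeff_sub,
    show k + 4 = (k + 3) + 1 from rfl, coeff_mul_X_pow, show k + 3 + 1 = (k + 2) + 2 from rfl,
    coeff_mul_X_pow, show k + 2 + 2 = (k + 1) + 3 from rfl, coeff_mul_X_pow,
    show k + 1 + 3 = k + 4 from rfl, coeff_mul_X_pow]
  have h4 := abs_coeff_mul_le (abs_coeff_pow_le abs_coeff_one_sub_X_sq_le 2)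
    (abs_krawtchoukGen_coeff_le le_rfl (by omega : u ≤ m)) (k + 4)
  simp only [coeff_one_add_C_mul_X_pow 1, one_pow, one_mul]
  have h5 : 4 * m.choose k ≤ m.choose (k + 1) := four_mul_choose_le (by omega)
  have h6 : 4 * m.choose (k + 1) ≤ m.choose (k + 2) := four_mul_choose_le (by omega)
  have h7 : 4 * m.choose (k + 2) ≤ m.choose (k + 3) := four_mul_choose_le (by omega)
  have h8 : 0 < m.choose k := Nat.choose_pos (by omega)
  omega

/-! ### Character sums over balls and the resulting count. -/

theorem krawtchoukGen_succ_succ (a : ℤ) (m u : ℕ) :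
    krawtchoukGen a (m + 1) (u + 1) = (1 - X) * krawtchoukGen a m u := by
  simp only [krawtchoukGen, Nat.add_sub_add_right]
  ring

theorem sum_range_coeff_one_sub_X_mul (p : ℤ[X]) (r : ℕ) :
    ∑ i ∈ Finset.range (r + 1), ((1 - X) * p).coeff i = p.coeff r := by
  induction r with
  | zero => simp [sub_mul]
  | succ r ih =>
    rw [Finset.sum_range_succ, ih, sub_mul, one_mul, coeff_sub, coeff_X_mul]
    ring

theorem exists_addChar_sum_support_le_eq {A : Type*} [AddCommGroup A] [Fintype A] [Nontrivial A]
    {n w : ℕ} (hw : w ≤ n) : ∃ χ : AddChar (Fin n → A) ℂ, ∀ r : ℕ,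
      ∑ β with (Function.support β).ncard ≤ r, χ β =
        ((∑ i ∈ Finset.range (r + 1),
          (krawtchoukGen ((Nat.card A : ℤ) - 1) n w).coeff i : ℤ) : ℂ) := by
  classical
  obtain ⟨x, hx⟩ := exists_ne (0 : A)
  obtain ⟨ψ, hψ⟩ := AddChar.exists_apply_ne_zero.2 hx
  have hψ1 : ψ ≠ 1 := by
    rintro rfl
    simp at hψ
  let χ : AddChar (Fin n → A) ℂ :=
    { toFun := fun β => ∏ i : Fin n, if (i : ℕ) < w then ψ (β i) else 1
      map_zero_eq_one' := by simp
      map_add_eq_mul' := fun β θ => by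
        rw [← Finset.prod_mul_distrib]
        refine Finset.prod_congr rfl fun i _ => ?_
        split_ifs <;> simp [AddChar.map_add_eq_mul] }
  have hsum : ∀ φ : AddChar A ℂ, ∑ y, C (φ y) * (if y = 0 then 1 else X : ℂ[X]) =
      1 + C (∑ y, φ y - 1) * X := by
    intro φ
    have h1 : ∀ y, C (φ y) * (if y = 0 then 1 else X : ℂ[X]) =
        C (φ y) * X + if y = 0 then 1 - X else 0 := by
      intro y
      split_ifs with h
      · simp [h]
      · simp
    simp only [h1, Finset.sum_add_distrib, Finset.sum_ite_eq', Finset.mem_univ, if_true,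
      ← Finset.sum_mul, map_sub, map_sum, map_one]
    ring
  -- The twisted weight enumerator factors over the coordinates: `1 - X` where `ψ` acts, `1 + (|A| -
  -- 1) X` elsewhere.
  have hgen : ∑ β : Fin n → A, C (χ β) * (X : ℂ[X]) ^ (Function.support β).ncard =
      (krawtchoukGen ((Nat.card A : ℤ) - 1) n w).map (Int.castRingHom ℂ) := by
    have h2 : ∀ β : Fin n → A, C (χ β) * (X : ℂ[X]) ^ (Function.support β).ncard =
        ∏ i : Fin n, C ((if (i : ℕ) < w then ψ else 1) (β i)) * (if β i = 0 then 1 else X) := by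
      intro β
      rw [Finset.prod_mul_distrib]
      congr 1
      · have hχ : χ β = ∏ i : Fin n, if (i : ℕ) < w then ψ (β i) else 1 := rfl
        rw [hχ, map_prod C]
        refine Finset.prod_congr rfl fun i _ => ?_
        split_ifs <;> simp
      · rw [Set.ncard_eq_toFinset_card', Finset.prod_ite]
        simp only [Finset.prod_const_one, one_mul, Finset.prod_const]
        congr 2
        ext
        simp
    have h3 := Finset.prod_univ_sum (fun _ : Fin n => (Finset.univ : Finset A))
      (fun i y => C ((if (i : ℕ) < w then ψ else 1 : AddChar A ℂ) y) *
        (if y = 0 then 1 else X : ℂ[X]))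
    rw [Fintype.piFinset_univ] at h3
    have h4 : ∀ i : Fin n, (1 : ℂ[X]) + C (∑ y, (if (i : ℕ) < w then ψ else 1 : AddChar A ℂ) y - 1) *
        X = if (i : ℕ) < w then 1 - X else
          1 + C ((Nat.card A : ℂ) - 1) * X := by
      intro i
      split_ifs
      · rw [AddChar.sum_eq_zero_of_ne_one hψ1]
        simp [sub_eq_add_neg]
      · simp
    have h5 : (Finset.univ.filter fun i : Fin n => (i : ℕ) < w).card = w := by
      rw [Fin.card_filter_val_lt, min_eq_right hw]
    have h6 : (Finset.univ.filter fun i : Fin n => ¬ (i : ℕ) < w).card = n - w := by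
      have := Finset.card_filter_add_card_filter_not (s := Finset.univ)
        (fun i : Fin n => (i : ℕ) < w)
      rw [h5, Finset.card_univ, Fintype.card_fin] at this
      omega
    calc _ = ∑ β : Fin n → A, ∏ i : Fin n, C ((if (i : ℕ) < w then ψ else 1 : AddChar A ℂ) (β i)) *
          (if β i = 0 then 1 else X : ℂ[X]) := Finset.sum_congr rfl fun β _ => h2 β
      _ = _ := by
        convert h3.symm using 1
        simp only [hsum, h4]
        rw [Finset.prod_ite, Finset.prod_const, Finset.prod_const, h5, h6]
        simp [krawtchoukGen]
  refine ⟨χ, fun r => ?_⟩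
  have h7 : ∀ i, ((krawtchoukGen ((Nat.card A : ℤ) - 1) n w).coeff i : ℂ) =
      ∑ β : Fin n → A, if (Function.support β).ncard = i then χ β else 0 := by
    intro i
    have := congrArg (fun p => p.coeff i) hgen
    simp only [finsetSum_coeff, coeff_C_mul, coeff_X_pow, coeff_map, mul_ite, mul_one, mul_zero,
      eq_intCast] at this
    rw [← this]
    simp only [eq_comm]
  push_cast
  simp only [h7]
  rw [Finset.sum_comm, Finset.sum_filter]
  refine Finset.sum_congr rfl fun β _ => ?_
  simp

theorem IsReflexivePartition.card_image_krawtchoukGen_le {X : Type*} [AddCommGroup X] [Finite X]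
    [Nontrivial X] {k m : ℕ} (hk : 0 < k) (hkm : k ≤ m + 1)
    (h : IsReflexivePartition (combPartition X (subsetsOfCard k (Fin (m + 1)))))
    [DecidableEq (ℕ → ℤ)] :
    ((Finset.range (m + 1)).image (fun u j =>
      (krawtchoukGen ((Nat.card X : ℤ) - 1) m u).coeff (j * k))).card ≤ m / k + 1 := by
  classical
  have := Fintype.ofFinite X
  set a : ℤ := (Nat.card X : ℤ) - 1
  have ha : 0 < a := by
    have := Finite.one_lt_card (α := X)
    omega
  set Γ := combPartition X (subsetsOfCard k (Fin (m + 1)))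
  have hcard := h.card_quotient_dualPartition_le.trans (card_quotient_combPartition_le hk hkm)
  let f : ℕ → Quotient Γ → ℂ := fun j => Quotient.lift
    (fun β => if combWeight (subsetsOfCard k (Fin (m + 1))) β ≤ j then 1 else 0)
    (fun β θ hβ => by
      have : combWeight _ β = combWeight _ θ := hβ
      simp only [this])
  let G : Quotient (dualPartition Γ) → ℕ → ℂ := Quotient.lift
    (fun χ j => ∑ β, f j ⟦β⟧ * χ β) (fun _ _ hχ => funext fun j => sum_mul_eq_of_dualPartition hχ _)
  have hG : ∀ w ≤ m + 1, (fun j => ((∑ i ∈ Finset.range (j * k + 1),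
      (krawtchoukGen a (m + 1) w).coeff i : ℤ) : ℂ)) ∈ Set.range G := by
    intro w hw
    obtain ⟨χ, hχ⟩ := exists_addChar_sum_support_le_eq (A := X) hw
    refine ⟨⟦χ⟧, funext fun j => ?_⟩
    rw [← hχ, Finset.sum_filter]
    refine Finset.sum_congr rfl fun β _ => ?_
    simp only [f, Quotient.lift_mk, combWeight_le_iff hk hkm, ite_mul, one_mul, zero_mul]
  set I := (Finset.range (m + 1)).image (fun u j => (krawtchoukGen a m u).coeff (j * k)) with hI
  let ι : (ℕ → ℤ) → ℕ → ℂ := fun g j => g j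
  have hι : Function.Injective ι := fun g g' hg => funext fun j =>
    Int.cast_injective (α := ℂ) (congrFun hg j)
  let g₀ : ℕ → ℤ := fun j => ∑ i ∈ Finset.range (j * k + 1), (krawtchoukGen a (m + 1) 0).coeff i
  have hg₀ : g₀ ∉ I := by
    intro hmem
    obtain ⟨u, hu, hgu⟩ := Finset.mem_image.1 hmem
    -- Index `(m + 1) * k` exceeds the degree `m`, so every member of `I` vanishes there, while the
    -- trivial character has a positive sum.
    have h1 := congrFun hgu (m + 1)
    have h2 : (krawtchoukGen a m u).coeff ((m + 1) * k) = 0 := by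
      refine coeff_eq_zero_of_natDegree_lt ?_
      have h3 := natDegree_krawtchoukGen_le (a := a) (Nat.lt_succ_iff.1 (Finset.mem_range.1 hu))
      have h4 := Nat.le_mul_of_pos_right (m + 1) hk
      omega
    have h5 : 0 < g₀ (m + 1) := by
      have h6 : ∀ i, (krawtchoukGen a (m + 1) 0).coeff i = a ^ i * (m + 1).choose i := by
        intro i
        rw [krawtchoukGen, pow_zero, one_mul, Nat.sub_zero, coeff_one_add_C_mul_X_pow]
      refine Finset.sum_pos' (fun i _ => ?_) ⟨0, by simp, ?_⟩
      · rw [h6]; positivity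
      · rw [h6]; simp
    simp only [h2] at h1
    omega
  have hsub : (((insert g₀ I).image ι : Finset (ℕ → ℂ)) : Set (ℕ → ℂ)) ⊆ Set.range G := by
    intro y hy
    obtain ⟨g, hg, rfl⟩ := Finset.mem_image.1 (Finset.mem_coe.1 hy)
    rcases Finset.mem_insert.1 hg with rfl | hg
    · exact hG 0 (Nat.zero_le _)
    · obtain ⟨u, hu, rfl⟩ := Finset.mem_image.1 hg
      have := hG (u + 1) (by have := Finset.mem_range.1 hu; omega)
      simpa only [krawtchoukGen_succ_succ, sum_range_coeff_one_sub_X_mul] using this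
  have h7 := Set.ncard_le_ncard hsub (Set.finite_range G)
  rw [Set.ncard_coe_finset, Finset.card_image_of_injective _ hι, Finset.card_insert_of_notMem hg₀] at h7
  have h8 : (Set.range G).ncard ≤ Nat.card (Quotient (dualPartition Γ)) := by
    rw [← Nat.card_coe_set_eq]
    exact Finite.card_range_le G
  omega

/-! ### Contradictions from the count. -/

section NonReflexive

variable {X : Type*} [AddCommGroup X] [Finite X] [Nontrivial X] {k m : ℕ}

theorem IsReflexivePartition.card_image_coeff_le (hk : 0 < k) (hkm : k ≤ m + 1)
    (h : IsReflexivePartition (combPartition X (subsetsOfCard k (Fin (m + 1))))) (j : ℕ) :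
    ((Finset.range (m + 1)).image (fun u =>
      (krawtchoukGen ((Nat.card X : ℤ) - 1) m u).coeff (j * k))).card ≤ m / k + 1 := by
  classical
  refine le_trans ?_ (h.card_image_krawtchoukGen_le hk hkm)
  have h1 : (Finset.range (m + 1)).image (fun u =>
      (krawtchoukGen ((Nat.card X : ℤ) - 1) m u).coeff (j * k)) =
      ((Finset.range (m + 1)).image (fun u j =>
      (krawtchoukGen ((Nat.card X : ℤ) - 1) m u).coeff (j * k))).image (fun g => g j) := by
    rw [Finset.image_image]
    rfl
  rw [h1]
  exact Finset.card_image_le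

/-- If the Krawtchouk values outside of `T` are different from those on `T`, then reflexivity
bounds the cardinality of `T`. -/
theorem IsReflexivePartition.card_le_of_disjoint (hk : 0 < k) (hkm : k ≤ m + 1)
    (h : IsReflexivePartition (combPartition X (subsetsOfCard k (Fin (m + 1)))))
    {T V : Finset ℕ} (hT : T ⊆ Finset.range (m + 1)) (hV : V ⊆ Finset.range (m + 1))
    (hinj : Set.InjOn (fun u => (krawtchoukGen ((Nat.card X : ℤ) - 1) m u).coeff k) V)
    (hne : ∀ u ∈ T, ∀ v ∈ V, (krawtchoukGen ((Nat.card X : ℤ) - 1) m u).coeff k ≠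
      (krawtchoukGen ((Nat.card X : ℤ) - 1) m v).coeff k) :
    T.card + k * V.card ≤ k * (m / k + 1) := by
  have ha : 0 < (Nat.card X : ℤ) - 1 := by
    have := Finite.one_lt_card (α := X)
    omega
  have h1 := h.card_image_coeff_le hk hkm 1
  rw [one_mul] at h1
  set g := fun u => (krawtchoukGen ((Nat.card X : ℤ) - 1) m u).coeff k
  have h2 : T.card ≤ k * (T.image g).card := Finset.card_le_mul_card_image T k fun v _ =>
    card_filter_krawtchoukGen_coeff_eq_le ha hk
      (fun u hu => Nat.lt_succ_iff.1 (Finset.mem_range.1 (hT hu))) v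
  have h3 : Disjoint (T.image g) (V.image g) := by
    rw [Finset.disjoint_left]
    intro x hx hx'
    obtain ⟨u, hu, rfl⟩ := Finset.mem_image.1 hx
    obtain ⟨v, hv, huv⟩ := Finset.mem_image.1 hx'
    exact hne u hu v hv huv.symm
  have h4 : (T.image g).card + V.card ≤ m / k + 1 := by
    rw [← Finset.card_image_of_injOn hinj, ← Finset.card_union_of_disjoint h3]
    exact (Finset.card_le_card (Finset.union_subset (Finset.image_subset_image hT)
      (Finset.image_subset_image hV))).trans h1
  calc T.card + k * V.card ≤ k * ((T.image g).card + V.card) := by rw [mul_add]; omega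
    _ ≤ k * (m / k + 1) := Nat.mul_le_mul_left k h4

/-- If `k ∣ m`, then `K_m(u) = ± a ^ (m - u)` already takes `m + 1` values. Otherwise the strict
maximum at `u = 0` forces `m ≤ k * (m / k)`, hence `k ∣ m`. -/
theorem not_isReflexivePartition_of_three_le_card (hq : 3 ≤ Nat.card X) (hk : 2 ≤ k)
    (hkm : k ≤ m) :
    ¬ IsReflexivePartition (combPartition X (subsetsOfCard k (Fin (m + 1)))) := by
  intro h
  have ha : 2 ≤ (Nat.card X : ℤ) - 1 := by omega
  by_cases hdvd : k ∣ m
  · have h1 := h.card_image_coeff_le (by omega) (by omega) (m / k)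
    rw [Nat.div_mul_cancel hdvd, Finset.card_image_of_injOn, Finset.card_range] at h1
    · have h2 : m / k < m := Nat.div_lt_self (by omega) (by omega)
      omega
    · intro u hu v hv huv
      have hu : u ≤ m := by simpa [Nat.lt_succ_iff] using hu
      have hv : v ≤ m := by simpa [Nat.lt_succ_iff] using hv
      simp only [krawtchoukGen_coeff_self hu, krawtchoukGen_coeff_self hv] at huv
      have h2 := congrArg Int.natAbs huv
      simp only [Int.natAbs_mul, Int.natAbs_pow, Int.natAbs_neg, Int.natAbs_one, one_pow,
        one_mul] at h2
      have h3 := Nat.pow_right_injective (by omega : 2 ≤ ((Nat.card X : ℤ) - 1).natAbs) h2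
      omega
  · have h1 := h.card_le_of_disjoint (by omega) (by omega) (T := Finset.Ioc 0 m) (V := {0})
      (fun u hu => by simp at hu ⊢; omega) (by simp) (by simp) (by
        intro u hu v hv
        rw [Finset.mem_singleton.1 hv]
        obtain ⟨hu0, hum⟩ := Finset.mem_Ioc.1 hu
        exact ((le_abs_self _).trans_lt
          (abs_krawtchoukGen_coeff_lt ha hum hu0 (by omega) hkm)).ne)
    rw [Nat.card_Ioc, Finset.card_singleton, mul_add] at h1
    have h2 := Nat.mul_div_le m k
    exact hdvd ⟨m / k, by omega⟩

theorem krawtchoukGen_one_coeff_sub {u : ℕ} (hu : u ≤ m) (i : ℕ) :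
    (krawtchoukGen 1 m (m - u)).coeff i = (-1) ^ i * (krawtchoukGen 1 m u).coeff i := by
  have h : krawtchoukGen 1 m (m - u) = (krawtchoukGen 1 m u).comp (C (-1) * X) := by
    simp only [krawtchoukGen, Nat.sub_sub_self hu, map_one, mul_comp, pow_comp, sub_comp, add_comp,
      one_comp, X_comp, map_neg]
    ring
  rw [h, comp_C_mul_X_coeff, mul_comm]

/-- For odd `k`, `K_k` is antisymmetric under `u ↦ m - u`, so both ends carry values taken only
once; the count then gives `m - 1 + 2 k ≤ m + k`. -/
theorem not_isReflexivePartition_of_card_eq_two_of_odd (hq : Nat.card X = 2) (hk : 2 ≤ k)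
    (hodd : Odd k) (hkm : k < m) :
    ¬ IsReflexivePartition (combPartition X (subsetsOfCard k (Fin (m + 1)))) := by
  intro h
  have h0 : 0 < (krawtchoukGen 1 m 0).coeff k :=
    (abs_nonneg _).trans_lt (abs_krawtchoukGen_one_coeff_lt (u := 1) (by omega) one_pos
      (by omega) hkm)
  have hm : (krawtchoukGen 1 m m).coeff k = -(krawtchoukGen 1 m 0).coeff k := by
    have := krawtchoukGen_one_coeff_sub (Nat.zero_le m) k
    rw [Nat.sub_zero, hodd.neg_one_pow] at this
    rw [this, neg_one_mul]
  have h1 := h.card_le_of_disjoint (by omega) (by omega) (T := Finset.Ioo 0 m) (V := {0, m})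
    (fun u hu => by simp at hu ⊢; omega) (fun u hu => by simp at hu ⊢; omega) (by
      rw [hq]
      norm_num
      rw [hm]
      intro _
      omega) (by
      rw [hq]
      norm_num
      intro u hu0 hum
      rw [hm]
      have := abs_lt.1 (abs_krawtchoukGen_one_coeff_lt hum hu0 (by omega) hkm)
      omega)
  rw [Nat.card_Ioo, Finset.card_pair (by omega), mul_add] at h1
  have h2 := Nat.mul_div_le m k
  omega

/-- The points `m - 1` and `m` repeat the values at `1` and `0` up to sign, so they are left out of
`T`. The count gives `m - 3 + 2 k ≤ m + k`, against `k ≥ 4`. -/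
theorem not_isReflexivePartition_of_card_eq_two_of_four_le (hq : Nat.card X = 2) (hk : 4 ≤ k)
    (hkm : 5 * k ≤ m) :
    ¬ IsReflexivePartition (combPartition X (subsetsOfCard k (Fin (m + 1)))) := by
  intro h
  have h0 := (le_abs_self _).trans_lt (abs_krawtchoukGen_one_coeff_lt (m := m) (u := 1) (k := k)
    (by omega) one_pos (by omega) (by omega))
  have h1 := h.card_le_of_disjoint (by omega) (by omega) (T := Finset.Icc 2 (m - 2)) (V := {0, 1})
    (fun u hu => by simp at hu ⊢; omega) (fun u hu => by simp at hu ⊢; omega) (by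
      rw [hq]
      norm_num
      omega) (by
      rw [hq]
      norm_num
      intro u hu2 hum
      have := (le_abs_self _).trans_lt
        (abs_krawtchoukGen_one_coeff_lt_one (by omega : u + 2 ≤ m) hu2 hk hkm)
      omega)
  rw [Nat.card_Icc, Finset.card_pair (by omega), mul_add] at h1
  have h2 := Nat.mul_div_le m k
  omega

end NonReflexive

/-! ### Assembly of the four statements. -/

theorem theorem4p2 {X : Type*} [AddCommGroup X] [Finite X] (q : ℕ) (hq : Nat.card X = q)
    (hq2 : 2 ≤ q) :
    (∀ k : ℕ, 2 ≤ k → (k, q) ≠ (2, 2) →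
      ∃ m : ℕ, 0 < m ∧ ∀ n : ℕ, m ≤ n → k + 1 ≤ n →
        ¬ IsReflexivePartition (combPartition X (subsetsOfCard k (Fin n)))) ∧
    (3 ≤ q → ∀ n : ℕ, 3 ≤ n →
      ¬ IsReflexivePartition (combPartition X (subsetsOfCard 2 (Fin n)))) ∧
    (∀ n : ℕ, 0 < n →
      ((3 ∣ n ∧
          (9 * ((q : ℝ) - 1) +
              √(48 * (q : ℝ) ^ 4 - 144 * (q : ℝ) ^ 3 + 189 * (q : ℝ) ^ 2 - 162 * (q : ℝ) + 81)) /
            (2 * (2 * (q : ℝ) - 3) ^ 2) + 3 ≤ (n : ℝ)) ∨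
        (n ≡ 1 [MOD 3] ∧ 4 ≤ n ∧ 3 ≤ q) ∨
        (n ≡ 2 [MOD 3] ∧
          (4 * (q : ℝ) ^ 2 + 3 * (q : ℝ) - 9 +
              √(48 * (q : ℝ) ^ 4 - 72 * (q : ℝ) ^ 3 + 9 * (q : ℝ) ^ 2 - 54 * (q : ℝ) + 81)) /
            (2 * (2 * (q : ℝ) - 3) ^ 2) + 3 ≤ (n : ℝ))) →
      4 ≤ n ∧ ¬ IsReflexivePartition (combPartition X (subsetsOfCard 3 (Fin n)))) ∧
    (q = 2 → ∀ n : ℕ, 5 ≤ n →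
      ¬ IsReflexivePartition (combPartition X (subsetsOfCard 3 (Fin n)))) := by
  subst hq
  have : Nontrivial X := Finite.one_lt_card_iff_nontrivial.1 hq2
  have hthree : 3 ≤ Nat.card X → ∀ k n : ℕ, 2 ≤ k → k + 1 ≤ n →
      ¬ IsReflexivePartition (combPartition X (subsetsOfCard k (Fin n))) := by
    intro hq k n hk hkn
    obtain ⟨m, rfl⟩ : ∃ m, n = m + 1 := ⟨n - 1, by omega⟩
    exact not_isReflexivePartition_of_three_le_card hq hk (by omega)
  have htwo : Nat.card X = 2 → ∀ n : ℕ, 5 ≤ n →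
      ¬ IsReflexivePartition (combPartition X (subsetsOfCard 3 (Fin n))) := by
    intro hq n hn
    obtain ⟨m, rfl⟩ : ∃ m, n = m + 1 := ⟨n - 1, by omega⟩
    exact not_isReflexivePartition_of_card_eq_two_of_odd hq (by omega) (by decide) (by omega)
  refine ⟨?_, fun hq n hn => hthree hq 2 n le_rfl hn, ?_, htwo⟩
  · intro k hk hkq
    refine ⟨5 * k + 1, by omega, fun n hn hkn => ?_⟩
    by_cases hq : 3 ≤ Nat.card X
    · exact hthree hq k n hk hkn
    · have hq : Nat.card X = 2 := by omega
      have hk2 : k ≠ 2 := fun hk2 => hkq (by rw [hk2, hq])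
      by_cases hk3 : k = 3
      · subst hk3
        exact htwo hq n (by omega)
      · obtain ⟨m, rfl⟩ : ∃ m, n = m + 1 := ⟨n - 1, by omega⟩
        exact not_isReflexivePartition_of_card_eq_two_of_four_le hq (by omega) (by omega)
  · intro n _ hcond
    have hqR : (2 : ℝ) ≤ Nat.card X := by exact_mod_cast hq2
    have hden : 0 < 2 * (2 * (Nat.card X : ℝ) - 3) ^ 2 := by
      have : 0 < 2 * (Nat.card X : ℝ) - 3 := by linarith
      positivity
    -- Only the positivity of the fractions matters: it gives `n > 3`, and the residue of `n` modulo
    -- 3 then excludes `n = 4`.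
    have hlt : ∀ x y : ℝ, 0 < x → (x + √y) / (2 * (2 * (Nat.card X : ℝ) - 3) ^ 2) + 3 ≤ (n : ℝ) →
        3 < n := by
      intro x y hx hxy
      have h1 := div_pos (add_pos_of_pos_of_nonneg hx (Real.sqrt_nonneg y)) hden
      have h2 : (3 : ℝ) < n := by linarith
      exact_mod_cast h2
    have hn : 4 ≤ n ∧ (3 ≤ Nat.card X ∨ 5 ≤ n) := by
      rcases hcond with ⟨hmod, hle⟩ | ⟨-, hn, hq⟩ | ⟨hmod, hle⟩
      · have := hlt _ _ (by linarith) hle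
        omega
      · exact ⟨hn, Or.inl hq⟩
      · have := hlt _ _ (by nlinarith) hle
        have : n % 3 = 2 := hmod
        omega
    refine ⟨hn.1, ?_⟩
    by_cases hq : 3 ≤ Nat.card X
    · exact hthree hq 3 n (by omega) hn.1
    · exact htwo (by omega) n (hn.2.resolve_left hq)
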